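/- **Setting.** There are $m$ items and two (possibly overlapping) groups $G_1,G_2\subseteq\{1,\dots,m\}$. For $\sigma=(\sigma_1,\sigma_2)\in\{0,1\}^2$ let $I_\sigma$ be the set of items $i$ such that, for $\ell=1,2$, $i\in G_\ell$ if and only if $\sigma_\ell=1$. The latent utilities $w_1,\dots,w_m$ are independent draws from a distribution $\mathcal D$ on $\mathbb R$ with nonnegative support and cumulative distribution function $F$; put $F^{-1}(p)=\inf\{x: F(x)\ge p\}$. For each $\sigma$ there is a strictly increasing bias function $b_\sigma:\mathbb R_{\ge0}\to\mathbb R_{\ge0}$, and an item $i\in I_\sigma$ has observed utility $\widehat w_i=b_\sigma(w_i)$. For constants $c,d>0$ assume: $\mathcal D$ has a probability density function which on $\mathrm{supp}(\mathcal D)$ is differentiable and takes values in $[c,1/c]$; and at every $x\in \mathrm{supp}(\mathcal D)$ each $b_\sigma$ is differentiable with $b_\sigma(x)\le 1/c$ and $d\le b_\sigma'(x)\le 1/c$. Given an integer $n$ and lower bounds $L_1,L_2\ge 0$, let $\widetilde x$ be a maximizer of $\sum_{i\in S}\widehat w_i$ over all $S\subseteq\{1,\dots,m\}$ with $|S|=n$,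 $|S\cap G_1|\ge L_1$, $|S\cap G_2|\ge L_2$, let $x^\star$ be a maximizer of $\sum_{i\in S}w_i$ over all $S$ with $|S|=n$, and let the utility ratio be $$\mathscr R_{\mathcal D}(L,b)=\mathbb E_w\left[\frac{\sum_{i\in\widetilde x}w_i}{\sum_{i\in x^\star}w_i}\right].$$ **Proposition.** For all $\varepsilon,\eta,\rho,c,d>0$ there is a threshold $m_0\in\mathbb N$, depending only on $\varepsilon,\eta,\rho,c,d$, such that the following holds for every $m\ge m_0$, every $n$ with $\eta<\frac nm<1-\eta$, all groups $G_1,G_2$ with $|I_\sigma|\ge\rho m$ for every $\sigma\in\{0,1\}^2$, and all $\mathcal D$ and $(b_\sigma)_\sigma$ as above. Put $q=F^{-1}\left(1-\frac nm\right)$. If $$b_{00}(q)-b_{10}(q)-b_{01}(q)+b_{11}(q)=0,$$ and the bias at $q$ is directed against the two groups, i.e. $b_{10}(q)\le b_{00}(q)$ and $b_{01}(q)\le b_{00}(q)$, then there are non-intersectional lower bounds $L_1,L_2\ge0$ proportional to the group sizes, namely $L_\ell=|G_\ell|\cdot\frac nm$ for $\ell=1,2$, for which the constraints are feasible and $$\mathscr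 R_{\mathcal D}(L,b)\ge 1-\varepsilon,$$ whichever maximizers $\widetilde x$ and $x^\star$ are selected when there are ties. -/

import Mathlib

open MeasureTheory ProbabilityTheory

noncomputable section

/-- The quantile function `F⁻¹(p) = inf {x | p ≤ F x}` of a distribution on `ℝ` with cumulative
distribution function `F`. -/
def quantile (D : Measure ℝ) (p : ℝ) : ℝ :=
  sInf {x : ℝ | p ≤ cdf D x}

/-- The intersection `I_{st}`: the items whose membership in `G₁` is `s` and whose membership in
`G₂` is `t`. -/
def intersection {m : ℕ} (G₁ G₂ : Finset (Fin m)) (s t : Bool) : Finset (Fin m) :=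
  {i | decide (i ∈ G₁) = s ∧ decide (i ∈ G₂) = t}

/-- The observed utility of every item: an item of the intersection `I_{st}` with latent utility
`x` is observed with utility `b s t x`. -/
def observed {m : ℕ} (b : Bool → Bool → ℝ → ℝ) (G₁ G₂ : Finset (Fin m)) (w : Fin m → ℝ) :
    Fin m → ℝ :=
  fun i => b (decide (i ∈ G₁)) (decide (i ∈ G₂)) (w i)

/-- The selections of `n` items that contain at least `L₁` items of `G₁` and at least `L₂` items
of `G₂`. -/
def feasible {m : ℕ} (n : ℕ) (G₁ G₂ : Finset (Fin m)) (L₁ L₂ : ℝ) : Set (Finset (Fin m)) :=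
  {S | S.card = n ∧ L₁ ≤ ((S ∩ G₁).card : ℝ) ∧ L₂ ≤ ((S ∩ G₂).card : ℝ)}

/-- `S` maximizes the total utility `∑ i ∈ S, u i` over the family `C` of selections. -/
def IsBestSelection {m : ℕ} (C : Set (Finset (Fin m))) (u : Fin m → ℝ) (S : Finset (Fin m)) :
    Prop :=
  S ∈ C ∧ ∀ T ∈ C, ∑ i ∈ T, u i ≤ ∑ i ∈ S, u i

/-- The law of the latent utilities of `m` items: independent draws from `D`. -/
def latentLaw (m : ℕ) (D : Measure ℝ) : Measure (Fin m → ℝ) :=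
  Measure.pi fun _ => D

/-- `⟨x̃, w⟩ / ⟨x⋆, w⟩`, for the selections `x̃ = xt w` and `x⋆ = xs w`. -/
def selectionRatio {m : ℕ} (xt xs : (Fin m → ℝ) → Finset (Fin m)) (w : Fin m → ℝ) : ℝ :=
  (∑ i ∈ xt w, w i) / ∑ i ∈ xs w, w i

/-- The utility ratio: the expectation of `⟨x̃, w⟩ / ⟨x⋆, w⟩` over the latent utilities `w`. -/
def utilityRatio {m : ℕ} (D : Measure ℝ) (xt xs : (Fin m → ℝ) → Finset (Fin m)) : ℝ :=
  ∫ w, selectionRatio xt xs w ∂(latentLaw m D)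

/-- `D` is a distribution with nonnegative support that has a probability density function `f`,
which on the support is differentiable and takes values between `c` and `1 / c`. -/
structure RegularDistribution (c : ℝ) (D : Measure ℝ) (f : ℝ → ℝ) : Prop where
  support_nonneg : D.support ⊆ Set.Ici 0
  measurable_density : Measurable f
  eq_withDensity : D = volume.withDensity fun x => ENNReal.ofReal (f x)
  differentiableOn_density : DifferentiableOn ℝ f D.support
  le_density : ∀ x ∈ D.support, c ≤ f x
  density_le : ∀ x ∈ D.support, f x ≤ 1 / c

/-- `g` is a strictly increasing function from `[0, ∞)` to `[0, ∞)` which at every point of the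
support of `D` is differentiable, has value at most `1 / c`, and has derivative between `d` and
`1 / c`. -/
structure RegularBias (c d : ℝ) (D : Measure ℝ) (g : ℝ → ℝ) : Prop where
  mapsTo : Set.MapsTo g (Set.Ici 0) (Set.Ici 0)
  strictMonoOn : StrictMonoOn g (Set.Ici 0)
  differentiableWithinAt : ∀ x ∈ D.support, DifferentiableWithinAt ℝ g (Set.Ici 0) x
  value_le : ∀ x ∈ D.support, g x ≤ 1 / c
  le_deriv : ∀ x ∈ D.support, d ≤ derivWithin g (Set.Ici 0) x
  deriv_le : ∀ x ∈ D.support, derivWithin g (Set.Ici 0) x ≤ 1 / c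

end

/-! The proof is Lagrangian duality with explicit multipliers. The vanishing alternating sum says
that the bias at `q` is additive over the groups: `b s t q` is `θ` minus `l₁` for membership in `G₁`
minus `l₂` for membership in `G₂`, where `θ = b₀₀(q)`, and `l₁, l₂ ≥ 0` because the bias is directed
against the groups. Once these multipliers are paid back, an item's adjusted utility is `g i`, the
increment of its bias function from `q` to `w i`, which has the sign of `w i - q`. So the relaxed
problem selects `W = {i | q < w i}`, the fair choice.

By concentration `W` takes a share close to `n / m` of every intersection, so some feasible `T` with
nearly tight constraints is close to it (`exists_feasible_near`). Comparing the optimal `S` with `T`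
bounds the sum of `|g|` over the symmetric difference of `W` and `S` (`sum_abs_sdiff_le`). Away from
a quantile window around `q` of small mass, `|g|` is bounded below (`RegularBias.mul_real_Icc_le`),
so that difference has few items. An item of the optimum `X` missed by `S` is worth no more than any
item of `S` in its own intersection; there are linearly many of these, so the loss is a small
fraction of the utility of `S` (`sum_best_le_of_counts`).

The exceptional event is handled by Chebyshev's inequality, and the arbitrary selectors are
measurable up to null sets because ties have probability zero. -/

/-! ### Quantiles of an atomless distribution and growth of the bias functions -/

lemma RegularDistribution.nullSingletonClass {c : ℝ} {D : Measure ℝ} {f : ℝ → ℝ}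
    (hD : RegularDistribution c D f) : NullSingletonClass D := by
  rw [hD.eq_withDensity]
  infer_instance

lemma cdf_sub_cdf_eq_real_Icc (D : Measure ℝ) [IsProbabilityMeasure D] [NullSingletonClass D] {x y : ℝ}
    (hxy : x ≤ y) : cdf D y - cdf D x = D.real (Set.Icc x y) := by
  rw [cdf_eq_real, cdf_eq_real, ← Set.Iic_union_Ioc_eq_Iic hxy,
    measureReal_union (by
      rw [Set.disjoint_left]; intro a ha hb; exact absurd ha (not_le.2 hb.1)) measurableSet_Ioc,
    measureReal_congr Ioc_ae_eq_Icc]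
  ring

lemma continuous_cdf (D : Measure ℝ) [IsProbabilityMeasure D] [NullSingletonClass D] :
    Continuous (cdf D) := by
  rw [continuous_iff_continuousAt]
  intro x
  refine ((cdf D).mono.continuousAt_iff_leftLim_eq_rightLim).2 ?_
  have h := (cdf D).measure_singleton x
  rw [measure_cdf, measure_singleton] at h
  have h1 := ENNReal.ofReal_eq_zero.1 h.symm
  rw [(cdf D).rightLim_eq]
  exact le_antisymm ((cdf D).mono.leftLim_le le_rfl) (by linarith)

lemma exists_cdf_eq (D : Measure ℝ) [IsProbabilityMeasure D] [NullSingletonClass D] {p : ℝ}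
    (h0 : 0 < p) (h1 : p < 1) : ∃ x, cdf D x = p := by
  obtain ⟨a, ha⟩ := ((tendsto_cdf_atBot D).eventually (gt_mem_nhds h0)).exists
  obtain ⟨b, hb⟩ := ((tendsto_cdf_atTop D).eventually (lt_mem_nhds h1)).exists
  exact mem_range_of_exists_le_of_exists_ge (continuous_cdf D) ⟨a, ha.le⟩ ⟨b, hb.le⟩

lemma isLeast_quantile (D : Measure ℝ) [IsProbabilityMeasure D] [NullSingletonClass D] {p : ℝ}
    (h0 : 0 < p) (h1 : p < 1) : IsLeast {x : ℝ | p ≤ cdf D x} (quantile D p) := by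
  obtain ⟨x, hx⟩ := exists_cdf_eq D h0 h1
  obtain ⟨a, ha⟩ := ((tendsto_cdf_atBot D).eventually (gt_mem_nhds h0)).exists
  have hbdd : BddBelow {x : ℝ | p ≤ cdf D x} :=
    ⟨a, fun y (hy : p ≤ cdf D y) => le_of_not_gt fun hya =>
      absurd (hy.trans (monotone_cdf D hya.le)) (not_le.2 ha)⟩
  have hcl : IsClosed {x : ℝ | p ≤ cdf D x} := isClosed_le continuous_const (continuous_cdf D)
  exact hcl.isLeast_csInf ⟨x, hx.ge⟩ hbdd

lemma cdf_quantile (D : Measure ℝ) [IsProbabilityMeasure D] [NullSingletonClass D] {p : ℝ}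
    (h0 : 0 < p) (h1 : p < 1) : cdf D (quantile D p) = p := by
  obtain ⟨x, hx⟩ := exists_cdf_eq D h0 h1
  have h := isLeast_quantile D h0 h1
  exact le_antisymm ((monotone_cdf D (h.2 hx.ge)).trans hx.le) h.1

/-- By minimality of the quantile, every interval ending at it on the right has positive mass. This
is needed because the bounds on the bias functions hold only on the support. -/
lemma quantile_mem_support (D : Measure ℝ) [IsProbabilityMeasure D] [NullSingletonClass D] {p : ℝ}
    (h0 : 0 < p) (h1 : p < 1) : quantile D p ∈ D.support := by
  rw [Measure.mem_support_iff_forall]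
  intro U hU
  obtain ⟨l, hl, hlU⟩ := exists_Ioc_subset_of_mem_nhds hU ⟨quantile D p - 1, by linarith⟩
  have hlt : cdf D l < p := by
    by_contra! h
    exact absurd ((isLeast_quantile D h0 h1).2 h) (not_le.2 hl)
  have h := cdf_sub_cdf_eq_real_Icc D hl.le
  rw [cdf_quantile D h0 h1, ← measureReal_congr Ioc_ae_eq_Icc] at h
  refine lt_of_lt_of_le ?_ (measure_mono hlU)
  have h' : 0 < D.real (Set.Ioc l (quantile D p)) := by rw [← h]; linarith
  exact (ENNReal.toReal_pos_iff.1 h').1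

/-- The support may have gaps, on which nothing is known about `g'`, so growth is measured by mass
rather than by length. On the part `K` of the support in the interval, change of variables gives the
image length at least `d * volume K`, and the density bound gives `volume K ≥ c * D K`. Monotonicity
places the image in `[g x, g y]`. -/
lemma RegularBias.mul_real_Icc_le {c d : ℝ} (hc : 0 < c) (hd : 0 < d) {D : Measure ℝ}
    [IsProbabilityMeasure D] {f : ℝ → ℝ} (hD : RegularDistribution c D f) {g : ℝ → ℝ}
    (hg : RegularBias c d D g) {x y : ℝ} (hx : 0 ≤ x) (hxy : x ≤ y) :
    d * c * D.real (Set.Icc x y) ≤ g y - g x := by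
  set K := D.support ∩ Set.Icc x y with hK
  have hKm : MeasurableSet K := Measure.isClosed_support.measurableSet.inter measurableSet_Icc
  have hK0 : K ⊆ Set.Ici 0 := fun z hz => hD.support_nonneg hz.1
  have hDK : D (Set.Icc x y) = D K := by
    rw [hK, Set.inter_comm]
    exact (measure_inter_conull' (by
      refine measure_mono_null ?_ (Measure.measure_compl_support (μ := D))
      exact fun z hz => hz.2)).symm
  have h1 : D K ≤ ENNReal.ofReal (1 / c) * volume K := by
    conv_lhs => rw [hD.eq_withDensity]
    rw [withDensity_apply _ hKm]
    calc ∫⁻ z in K, ENNReal.ofReal (f z) ≤ ∫⁻ _ in K, ENNReal.ofReal (1 / c) :=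
          setLIntegral_mono measurable_const fun z hz =>
            ENNReal.ofReal_le_ofReal (hD.density_le z hz.1)
      _ = _ := by simp
  have h2 : ENNReal.ofReal d * volume K ≤ volume (g '' K) := by
    rw [← lintegral_deriv_eq_volume_image_of_monotoneOn hKm
      (fun z hz => ((hg.differentiableWithinAt z hz.1).hasDerivWithinAt).mono hK0)
      (hg.strictMonoOn.monotoneOn.mono hK0)]
    calc ENNReal.ofReal d * volume K = ∫⁻ _ in K, ENNReal.ofReal d := by simp
      _ ≤ _ := setLIntegral_mono' hKm fun z hz => ENNReal.ofReal_le_ofReal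
            (hg.le_deriv z hz.1)
  have hmono := hg.strictMonoOn.monotoneOn
  have h3 : volume (g '' K) ≤ ENNReal.ofReal (g y - g x) := by
    rw [← Real.volume_Icc]
    refine measure_mono ?_
    rintro _ ⟨z, hz, rfl⟩
    exact ⟨hmono hx (hK0 hz) hz.2.1, hmono (hK0 hz) (hx.trans hxy) hz.2.2⟩
  have h4 : ENNReal.ofReal (d * c) * D (Set.Icc x y) ≤ ENNReal.ofReal (g y - g x) := by
    rw [hDK]
    calc ENNReal.ofReal (d * c) * D K
        ≤ ENNReal.ofReal (d * c) * (ENNReal.ofReal (1 / c) * volume K) := by gcongr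
      _ = ENNReal.ofReal d * volume K := by
          rw [← mul_assoc, ← ENNReal.ofReal_mul (by positivity)]
          congr 2; field_simp
      _ ≤ _ := h2.trans h3
  have h5 : 0 ≤ g y - g x := sub_nonneg.2 (hmono hx (hx.trans hxy) hxy)
  rw [← ENNReal.ofReal_le_ofReal_iff h5, ENNReal.ofReal_mul (by positivity), ofReal_measureReal]
  exact h4

/-! ### Concentration of counts -/

/-- Chebyshev's inequality for a sum of independent `[0, 1]`-valued variables, whose variance is at
most `m`. -/
lemma measure_count_deviation_le {m : ℕ} (D : Measure ℝ) [IsProbabilityMeasure D] {A : Set ℝ}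
    (hA : MeasurableSet A) (I : Finset (Fin m)) {δ : ℝ} (hδ : 0 < δ) (hm : 0 < m) :
    (latentLaw m D).real {w | δ * m ≤ |(∑ i ∈ I, A.indicator 1 (w i)) - I.card * D.real A|}
      ≤ 1 / (δ ^ 2 * m) := by
  let X : Fin m → ℝ → ℝ := fun i => if i ∈ I then A.indicator 1 else 0
  have hXm : ∀ i, Measurable (X i) := fun i => by
    by_cases hi : i ∈ I
    · simpa [X, hi] using measurable_one.indicator hA
    · simpa [X, hi] using measurable_zero
  have hXb : ∀ i x, X i x ∈ Set.Icc (0 : ℝ) 1 := fun i x => by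
    by_cases hi : i ∈ I <;> by_cases hx : x ∈ A <;> simp [X, hi, hx]
  have hXL : ∀ i, MemLp (X i) 2 D := fun i =>
    MemLp.of_bound (hXm i).aestronglyMeasurable 1 (Filter.Eventually.of_forall fun x => by
      rw [Real.norm_eq_abs, abs_of_nonneg (hXb i x).1]; exact (hXb i x).2)
  have hXpi : ∀ i, MemLp (fun w : Fin m → ℝ => X i (w i)) 2 (latentLaw m D) := fun i =>
    (hXL i).comp_measurePreserving (measurePreserving_eval (fun _ : Fin m => D) i)
  have hsum : ∀ w : Fin m → ℝ,
      (∑ i, fun w : Fin m → ℝ => X i (w i)) w = ∑ i ∈ I, A.indicator 1 (w i) := fun w => by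
    rw [Finset.sum_apply, ← Finset.sum_filter_add_sum_filter_not Finset.univ (· ∈ I)]
    rw [Finset.sum_congr rfl (g := fun i => A.indicator 1 (w i))
        (fun i hi => by simp [X, (Finset.mem_filter.1 hi).2]),
      Finset.sum_congr (s₁ := Finset.univ.filter (· ∉ I)) rfl (g := fun i => 0)
        (fun i hi => by simp [X, (Finset.mem_filter.1 hi).2])]
    simp
  have : IsProbabilityMeasure (latentLaw m D) := by unfold latentLaw; infer_instance
  have hint : ∫ w, (∑ i, fun w : Fin m → ℝ => X i (w i)) w ∂latentLaw m D
      = I.card * D.real A := by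
    simp_rw [Finset.sum_apply]
    rw [integral_finsetSum _ fun i _ => (hXpi i).integrable (by norm_num)]
    have : ∀ i, ∫ w, X i (w i) ∂latentLaw m D = if i ∈ I then D.real A else 0 := fun i => by
      rw [latentLaw, integral_comp_eval (μ := fun _ => D) (hXm i).aestronglyMeasurable]
      by_cases hi : i ∈ I
      · simp [X, hi, integral_indicator_one hA]
      · simp [X, hi]
    simp [this]
  have hvar : Var[∑ i, fun w : Fin m → ℝ => X i (w i); latentLaw m D] ≤ m := by
    rw [latentLaw, variance_sum_pi hXL]
    calc ∑ i, Var[X i; D] ≤ ∑ _i : Fin m, (1 : ℝ) := Finset.sum_le_sum fun i _ =>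
          (variance_le_sq_of_bounded (Filter.Eventually.of_forall (hXb i))
            (hXm i).aemeasurable).trans (by norm_num)
      _ = m := by simp
  have hm' : (0 : ℝ) < m := Nat.cast_pos.2 hm
  have h := meas_ge_le_variance_div_sq (memLp_finsetSum' Finset.univ fun i _ => hXpi i)
    (mul_pos hδ hm')
  rw [hint] at h
  simp_rw [hsum] at h
  refine (ENNReal.toReal_le_of_le_ofReal (by positivity)
    (h.trans (ENNReal.ofReal_le_ofReal (?_ : _ ≤ 1 / (δ ^ 2 * m)))))
  calc _ ≤ (m : ℝ) / (δ * m) ^ 2 := by gcongr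
    _ = _ := by field_simp

/-! ### Ties are null, and selections are measurable -/

lemma ae_mem_latentLaw {m : ℕ} {D : Measure ℝ} [IsProbabilityMeasure D] {A : Set ℝ}
    (hA : ∀ᵐ x ∂D, x ∈ A) : ∀ᵐ w ∂latentLaw m D, ∀ i, w i ∈ A :=
  ae_all_iff.2 fun i =>
    (Measure.quasiMeasurePreserving_eval (μ := fun _ : Fin m => D) (i := i)).ae hA

lemma StrictMonoOn.measurable_comp_max {β : ℝ → ℝ} (hβ : StrictMonoOn β (Set.Ici 0)) :
    Measurable fun x => β (max x 0) :=
  Monotone.measurable fun _ _ hxy => hβ.monotoneOn (Set.mem_Ici.2 (le_max_right _ _))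
    (Set.mem_Ici.2 (le_max_right _ _)) (max_le_max_right 0 hxy)

/-- Some coordinate `i` lies in exactly one of `S` and `T`. With the others fixed, injectivity of `β
i` leaves at most one nonnegative value of `w i` giving a tie, and `D` has no atoms; Fubini
concludes. -/
lemma ae_sum_ne_sum {m : ℕ} {D : Measure ℝ} [IsProbabilityMeasure D] [NullSingletonClass D]
    (h0 : ∀ᵐ x ∂D, x ∈ Set.Ici (0 : ℝ)) {β : Fin m → ℝ → ℝ}
    (hβ : ∀ i, StrictMonoOn (β i) (Set.Ici 0)) {S T : Finset (Fin m)} (hST : S ≠ T) :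
    ∀ᵐ w ∂latentLaw m D, ∑ i ∈ S, β i (w i) ≠ ∑ i ∈ T, β i (w i) := by
  let v : Fin m → ℝ := fun i => (if i ∈ S then 1 else 0) - (if i ∈ T then 1 else 0)
  -- Truncating at `0` makes the summands monotone, hence measurable, on the whole line; almost
  -- surely it changes nothing.
  let N : Set (Fin m → ℝ) := {w | ∑ i, v i * β i (max (w i) 0) = 0}
  have hN : MeasurableSet N := by
    refine measurableSet_eq_fun (Finset.measurable_sum _ fun i _ => ?_) measurable_const
    exact ((hβ i).measurable_comp_max.comp (measurable_pi_apply i)).const_mul _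
  obtain ⟨i, hi⟩ : ∃ i, v i ≠ 0 := by
    by_contra! h
    refine hST (Finset.ext fun i => ?_)
    have hvi : v i = 0 := h i
    by_cases h1 : i ∈ S <;> by_cases h2 : i ∈ T <;> simp [v, h1, h2] at hvi ⊢
  have hslice : ∀ w : Fin m → ℝ, D {y | Function.update w i y ∈ N} = 0 := fun w => by
    have hsub : ({y | Function.update w i y ∈ N} ∩ Set.Ici 0).Subsingleton := by
      rintro y ⟨hy, hy0⟩ z ⟨hz, hz0⟩
      simp only [N, Set.mem_ofPred_eq] at hy hz
      rw [← Finset.add_sum_erase _ _ (Finset.mem_univ i)] at hy hz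
      rw [Finset.sum_congr rfl (g := fun j => v j * β j (max (w j) 0)) (fun j hj => by
        rw [Function.update_of_ne (Finset.ne_of_mem_erase hj)])] at hy hz
      simp only [Function.update_self, max_eq_left (Set.mem_Ici.1 hy0),
        max_eq_left (Set.mem_Ici.1 hz0)] at hy hz
      exact (hβ i).injOn hy0 hz0 (mul_left_cancel₀ hi (by linarith))
    have h1 := hsub.measure_zero D
    rw [← h1]
    exact (measure_inter_conull h0).symm
  have hN0 : latentLaw m D N = 0 := by
    rw [latentLaw, ← lintegral_indicator_one hN,
      lintegral_eq_lmarginal_univ (μ := fun _ => D) (fun _ => 0),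
      lmarginal_erase' _ (measurable_one.indicator hN) (Finset.mem_univ i)]
    have : (fun w : Fin m → ℝ => ∫⁻ y, N.indicator 1 (Function.update w i y) ∂D)
        = fun _ => (0 : ENNReal) := by
      funext w
      have h2 : MeasurableSet {y | Function.update w i y ∈ N} :=
        (measurable_update w) hN
      rw [← hslice w, ← lintegral_indicator_one h2]
      rfl
    rw [this]
    simp [lmarginal]
  have hae : ∀ᵐ w ∂latentLaw m D, w ∉ N := measure_eq_zero_iff_ae_notMem.1 hN0
  filter_upwards [hae, ae_mem_latentLaw h0] with w hw hw0 heq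
  refine hw ?_
  simp only [N, Set.mem_ofPred_eq, max_eq_left (Set.mem_Ici.1 (hw0 _)), v, sub_mul, ite_mul, one_mul,
    zero_mul, Finset.sum_sub_distrib, Finset.sum_ite_mem, Finset.univ_inter]
  exact sub_eq_zero.2 heq

/-- The selector is an arbitrary function, but outside the null set of ties it chooses `S` exactly
when `S` is optimal, which is a measurable condition. -/
lemma nullMeasurableSet_bestSelection {m : ℕ} {D : Measure ℝ} [IsProbabilityMeasure D]
    [NullSingletonClass D] (h0 : ∀ᵐ x ∂D, x ∈ Set.Ici (0 : ℝ)) {β : Fin m → ℝ → ℝ}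
    (hβ : ∀ i, StrictMonoOn (β i) (Set.Ici 0)) {C : Set (Finset (Fin m))}
    {x : (Fin m → ℝ) → Finset (Fin m)}
    (hx : ∀ w, IsBestSelection C (fun i => β i (w i)) (x w)) (S : Finset (Fin m)) :
    NullMeasurableSet {w | x w = S} (latentLaw m D) := by
  classical
  let B : Set (Fin m → ℝ) := {_w | S ∈ C} ∩ ⋂ T ∈ C,
    {w | ∑ i ∈ T, β i (max (w i) 0) ≤ ∑ i ∈ S, β i (max (w i) 0)}
  have hmeas : ∀ T : Finset (Fin m), Measurable fun w : Fin m → ℝ => ∑ i ∈ T, β i (max (w i) 0) :=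
    fun T => Finset.measurable_sum _ fun i _ =>
      (hβ i).measurable_comp_max.comp (measurable_pi_apply i)
  have hB : MeasurableSet B := by
    refine (MeasurableSet.const (S ∈ C)).inter ?_
    exact MeasurableSet.iInter fun T => MeasurableSet.iInter fun _ =>
      measurableSet_le (hmeas T) (hmeas S)
  refine hB.nullMeasurableSet.congr ?_
  have hne : ∀ᵐ w ∂latentLaw m D, ∀ T U : Finset (Fin m), T ≠ U →
      ∑ i ∈ T, β i (w i) ≠ ∑ i ∈ U, β i (w i) :=
    ae_all_iff.2 fun T => ae_all_iff.2 fun U => by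
      by_cases h : T = U
      · exact Filter.Eventually.of_forall fun _ h' => absurd h h'
      · filter_upwards [ae_sum_ne_sum h0 hβ h] with w hw _ using hw
  filter_upwards [hne, ae_mem_latentLaw h0] with w hw hw0
  have hmax : ∀ i, max (w i) 0 = w i := fun i => max_eq_left (hw0 i)
  refine propext ⟨fun ⟨hS, h⟩ => ?_, fun h => ?_⟩
  · simp only [Set.mem_iInter, Set.mem_ofPred_eq, hmax] at h
    by_contra hcon
    exact hw _ _ hcon (le_antisymm (h _ (hx w).1) ((hx w).2 S hS))
  · have h' : x w = S := h
    have hb := hx w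
    rw [h'] at hb
    refine ⟨hb.1, Set.mem_iInter₂.2 fun T hT => ?_⟩
    simp only [Set.mem_ofPred_eq, hmax]
    exact hb.2 T hT

lemma aestronglyMeasurable_selectionRatio {m : ℕ} {μ : Measure (Fin m → ℝ)}
    {xt xs : (Fin m → ℝ) → Finset (Fin m)} (ht : ∀ S, NullMeasurableSet {w | xt w = S} μ)
    (hs : ∀ S, NullMeasurableSet {w | xs w = S} μ) :
    AEStronglyMeasurable (selectionRatio xt xs) μ := by
  have h : selectionRatio xt xs = fun w => ∑ S : Finset (Fin m), ∑ T : Finset (Fin m),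
      ({w | xt w = S} ∩ {w | xs w = T}).indicator
        (fun w => (∑ i ∈ S, w i) / ∑ i ∈ T, w i) w := by
    funext w
    rw [Finset.sum_eq_single (xt w), Finset.sum_eq_single (xs w)]
    · simp [selectionRatio]
    · intro T _ hT
      exact Set.indicator_of_notMem (fun hmem => hT hmem.2.symm) _
    · simp
    · intro S _ hS
      exact Finset.sum_eq_zero fun T _ =>
        Set.indicator_of_notMem (fun hmem => hS hmem.1.symm) _
    · simp
  rw [h]
  refine Finset.aestronglyMeasurable_fun_sum _ fun S _ =>
    Finset.aestronglyMeasurable_fun_sum _ fun T _ => ?_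
  refine AEStronglyMeasurable.indicator₀ ?_ ((ht S).inter (hs T))
  exact Measurable.aestronglyMeasurable (by fun_prop)

/-! ### Combinatorics of selections -/

section Selections

variable {m n : ℕ} {G₁ G₂ : Finset (Fin m)}

lemma mem_intersection {s t : Bool} {i : Fin m} :
    i ∈ intersection G₁ G₂ s t ↔ decide (i ∈ G₁) = s ∧ decide (i ∈ G₂) = t := by
  simp [intersection]

lemma card_eq_sum_inter_intersection (X : Finset (Fin m)) :
    X.card = (X ∩ intersection G₁ G₂ false false).card + (X ∩ intersection G₁ G₂ true false).card
      + (X ∩ intersection G₁ G₂ false true).card + (X ∩ intersection G₁ G₂ true true).card := by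
  rw [← Finset.card_union_of_disjoint, ← Finset.card_union_of_disjoint,
    ← Finset.card_union_of_disjoint]
  · congr 1
    ext i
    by_cases h1 : i ∈ G₁ <;> by_cases h2 : i ∈ G₂ <;> simp [mem_intersection, h1, h2]
  all_goals
    rw [Finset.disjoint_left]
    intro i
    by_cases h1 : i ∈ G₁ <;> by_cases h2 : i ∈ G₂ <;> simp [mem_intersection, h1, h2]

lemma card_inter_left_eq (X : Finset (Fin m)) :
    (X ∩ G₁).card = (X ∩ intersection G₁ G₂ true false).card
      + (X ∩ intersection G₁ G₂ true true).card := by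
  rw [← Finset.card_union_of_disjoint]
  · congr 1
    ext i
    by_cases h1 : i ∈ G₁ <;> by_cases h2 : i ∈ G₂ <;> simp [mem_intersection, h1, h2]
  · rw [Finset.disjoint_left]
    intro i
    by_cases h1 : i ∈ G₁ <;> by_cases h2 : i ∈ G₂ <;> simp [mem_intersection, h1, h2]

lemma card_inter_right_eq (X : Finset (Fin m)) :
    (X ∩ G₂).card = (X ∩ intersection G₁ G₂ false true).card
      + (X ∩ intersection G₁ G₂ true true).card := by
  rw [← Finset.card_union_of_disjoint]
  · congr 1
    ext i
    by_cases h1 : i ∈ G₁ <;> by_cases h2 : i ∈ G₂ <;> simp [mem_intersection, h1, h2]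
  · rw [Finset.disjoint_left]
    intro i
    by_cases h1 : i ∈ G₁ <;> by_cases h2 : i ∈ G₂ <;> simp [mem_intersection, h1, h2]

/-- Rounding up the totals of the two groups and of their overlap, rather than the four cells, keeps
each group constraint satisfied with excess below one. The other cells follow by subtraction, each
with error at most 2; `hlo` and `hhi` keep them between `0` and `N s t`. -/
lemma exists_rounding {N : Bool → Bool → ℕ} {r : ℝ}
    (hn : (n : ℝ) = ((N false false + N true false + N false true + N true true : ℕ) : ℝ) * r)
    (hlo : ∀ s t, 2 ≤ N s t * r) (hhi : ∀ s t, N s t * r + 2 ≤ N s t) :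
    ∃ k : Bool → Bool → ℕ, (∀ s t, k s t ≤ N s t) ∧ (∀ s t, |(k s t : ℝ) - N s t * r| ≤ 2) ∧
      k false false + k true false + k false true + k true true = n ∧
      (N true false + N true true : ℕ) * r ≤ (k true false + k true true : ℕ) ∧
      (k true false + k true true : ℕ) ≤ (N true false + N true true : ℕ) * r + 1 ∧
      (N false true + N true true : ℕ) * r ≤ (k false true + k true true : ℕ) ∧
      (k false true + k true true : ℕ) ≤ (N false true + N true true : ℕ) * r + 1 := by
  push_cast at hn ⊢
  obtain ⟨a, ha⟩ : ∃ a : ℤ, a = ⌈(N true true : ℝ) * r⌉ := ⟨_, rfl⟩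
  obtain ⟨x, hx⟩ : ∃ x : ℤ, x = ⌈((N true false : ℝ) + N true true) * r⌉ := ⟨_, rfl⟩
  obtain ⟨y, hy⟩ : ∃ y : ℤ, y = ⌈((N false true : ℝ) + N true true) * r⌉ := ⟨_, rfl⟩
  have ha1 := Int.le_ceil ((N true true : ℝ) * r)
  have ha2 := Int.ceil_lt_add_one ((N true true : ℝ) * r)
  have hx1 := Int.le_ceil (((N true false : ℝ) + N true true) * r)
  have hx2 := Int.ceil_lt_add_one (((N true false : ℝ) + N true true) * r)
  have hy1 := Int.le_ceil (((N false true : ℝ) + N true true) * r)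
  have hy2 := Int.ceil_lt_add_one (((N false true : ℝ) + N true true) * r)
  rw [← ha] at ha1 ha2
  rw [← hx] at hx1 hx2
  rw [← hy] at hy1 hy2
  have l00 := hlo false false
  have l10 := hlo true false
  have l01 := hlo false true
  have l11 := hlo true true
  have u00 := hhi false false
  have u10 := hhi true false
  have u01 := hhi false true
  have u11 := hhi true true
  obtain ⟨k11, h11⟩ := Int.eq_ofNat_of_zero_le (a := a) (by
    rw [← Int.cast_nonneg_iff (R := ℝ)]; linarith)
  obtain ⟨k10, h10⟩ := Int.eq_ofNat_of_zero_le (a := x - a) (by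
    rw [← Int.cast_nonneg_iff (R := ℝ)]; push_cast; linarith)
  obtain ⟨k01, h01⟩ := Int.eq_ofNat_of_zero_le (a := y - a) (by
    rw [← Int.cast_nonneg_iff (R := ℝ)]; push_cast; linarith)
  obtain ⟨k00, h00⟩ := Int.eq_ofNat_of_zero_le (a := n - x - y + a) (by
    rw [← Int.cast_nonneg_iff (R := ℝ)]; push_cast; linarith)
  have e11 : (k11 : ℝ) = a := by exact_mod_cast h11.symm
  have e10 : (k10 : ℝ) = x - a := by exact_mod_cast h10.symm
  have e01 : (k01 : ℝ) = y - a := by exact_mod_cast h01.symm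
  have e00 : (k00 : ℝ) = n - x - y + a := by exact_mod_cast h00.symm
  refine ⟨fun s t => if s then (if t then k11 else k10) else (if t then k01 else k00),
    ?_, ?_, ?_, ?_, ?_, ?_, ?_⟩
  · intro s t
    rw [← Nat.cast_le (α := ℝ)]
    cases s <;> cases t <;> simp only [if_true, Bool.false_eq_true, if_false] <;> linarith
  · intro s t
    rw [abs_le]
    cases s <;> cases t <;> simp only [if_true, Bool.false_eq_true, if_false] <;>
      constructor <;> linarith
  · simp only [if_true, Bool.false_eq_true, if_false]
    omega
  all_goals
    simp only [if_true, Bool.false_eq_true, if_false]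
    linarith

lemma exists_card_eq_card_sdiff_le (A I : Finset (Fin m)) {k : ℕ} (hk : k ≤ I.card) :
    ∃ T ⊆ I, T.card = k ∧
      ((T \ A).card : ℝ) + ((A ∩ I) \ T).card ≤ |(k : ℝ) - (A ∩ I).card| := by
  rcases le_total (A ∩ I).card k with h | h
  · obtain ⟨T, hAT, hTI, hT⟩ :=
      Finset.exists_subsuperset_card_eq (Finset.inter_subset_right (s₁ := A) (s₂ := I)) h hk
    refine ⟨T, hTI, hT, ?_⟩
    have h1 : (A ∩ I) \ T = ∅ := Finset.sdiff_eq_empty_iff_subset.2 hAT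
    have h2 : T \ A = T \ (A ∩ I) := by
      ext i
      simp only [Finset.mem_sdiff, Finset.mem_inter]
      exact ⟨fun h => ⟨h.1, fun h' => h.2 h'.1⟩, fun h => ⟨h.1, fun h' => h.2 ⟨h', hTI h.1⟩⟩⟩
    rw [h1, h2, Finset.cast_card_sdiff hAT, hT, Finset.card_empty, Nat.cast_zero, add_zero]
    exact le_abs_self _
  · obtain ⟨T, hTA, hT⟩ := Finset.exists_subset_card_eq h
    refine ⟨T, hTA.trans Finset.inter_subset_right, hT, ?_⟩
    have h1 : T \ A = ∅ := Finset.sdiff_eq_empty_iff_subset.2 (hTA.trans Finset.inter_subset_left)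
    rw [h1, Finset.cast_card_sdiff hTA, hT, abs_sub_comm, Finset.card_empty, Nat.cast_zero,
      zero_add]
    exact le_abs_self _

lemma exists_selection_near (W : Finset (Fin m)) {k : Bool → Bool → ℕ}
    (hk : ∀ s t, k s t ≤ (intersection G₁ G₂ s t).card) {a : ℝ}
    (ha : ∀ s t, |(k s t : ℝ) - (W ∩ intersection G₁ G₂ s t).card| ≤ a) :
    ∃ T : Finset (Fin m), (∀ s t, (T ∩ intersection G₁ G₂ s t).card = k s t) ∧
      ((T \ W).card : ℝ) + (W \ T).card ≤ 4 * a := by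
  choose P hPI hPk hP using fun s t => exists_card_eq_card_sdiff_le W _ (hk s t)
  let T : Finset (Fin m) := Finset.univ.filter fun i => i ∈ P (decide (i ∈ G₁)) (decide (i ∈ G₂))
  have hT : ∀ s t, T ∩ intersection G₁ G₂ s t = P s t := fun s t => by
    ext i
    simp only [T, Finset.mem_inter, Finset.mem_filter, Finset.mem_univ, true_and]
    constructor
    · rintro ⟨h, hi⟩
      obtain ⟨rfl, rfl⟩ := mem_intersection.1 hi
      exact h
    · intro h
      have hi := hPI s t h
      obtain ⟨h1, h2⟩ := mem_intersection.1 hi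
      exact ⟨by rw [h1, h2]; exact h, hi⟩
  refine ⟨T, fun s t => by rw [hT, hPk], ?_⟩
  rw [card_eq_sum_inter_intersection (G₁ := G₁) (G₂ := G₂) (T \ W),
    card_eq_sum_inter_intersection (G₁ := G₁) (G₂ := G₂) (W \ T)]
  have h1 : ∀ s t, (T \ W) ∩ intersection G₁ G₂ s t = P s t \ W := fun s t => by
    rw [← hT, Finset.sdiff_inter_right_comm]
  have h2 : ∀ s t, (W \ T) ∩ intersection G₁ G₂ s t
      = (W ∩ intersection G₁ G₂ s t) \ P s t := fun s t => by
    rw [← hT]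
    ext i
    simp only [Finset.mem_inter, Finset.mem_sdiff]
    tauto
  simp only [h1, h2]
  push_cast
  linarith [(hP false false).trans (ha false false), (hP true false).trans (ha true false),
    (hP false true).trans (ha false true), (hP true true).trans (ha true true)]

lemma IsBestSelection.le_of_swap {C : Set (Finset (Fin m))} {u : Fin m → ℝ} {S : Finset (Fin m)}
    (hS : IsBestSelection C u S) {i j : Fin m} (hi : i ∉ S) (hj : j ∈ S)
    (hC : insert i (S.erase j) ∈ C) : u i ≤ u j := by
  have h := hS.2 _ hC
  rw [Finset.sum_insert (fun h' => hi (Finset.mem_of_mem_erase h')),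
    ← Finset.add_sum_erase S u hj] at h
  linarith

lemma card_swap {S : Finset (Fin m)} {i j : Fin m} (hi : i ∉ S) (hj : j ∈ S) :
    (insert i (S.erase j)).card = S.card := by
  rw [Finset.card_insert_of_notMem (fun h' => hi (Finset.mem_of_mem_erase h')),
    Finset.card_erase_add_one hj]

lemma card_swap_inter {S G : Finset (Fin m)} {i j : Fin m} (hi : i ∉ S) (hj : j ∈ S)
    (hG : i ∈ G ↔ j ∈ G) : (insert i (S.erase j) ∩ G).card = (S ∩ G).card := by
  by_cases h : i ∈ G
  · rw [Finset.insert_inter_of_mem h, Finset.erase_inter]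
    exact card_swap (fun h' => hi (Finset.mem_inter.1 h').1) (Finset.mem_inter.2 ⟨hj, hG.1 h⟩)
  · rw [Finset.insert_inter_of_notMem h, Finset.erase_inter, Finset.erase_eq_of_notMem]
    exact fun h' => h (hG.2 (Finset.mem_inter.1 h').2)

lemma swap_mem_feasible {L₁ L₂ : ℝ} {S : Finset (Fin m)} (hS : S ∈ feasible n G₁ G₂ L₁ L₂)
    {s t : Bool} {i j : Fin m} (hi : i ∈ intersection G₁ G₂ s t)
    (hj : j ∈ intersection G₁ G₂ s t) (hiS : i ∉ S) (hjS : j ∈ S) :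
    insert i (S.erase j) ∈ feasible n G₁ G₂ L₁ L₂ := by
  obtain ⟨hi1, hi2⟩ := mem_intersection.1 hi
  obtain ⟨hj1, hj2⟩ := mem_intersection.1 hj
  have h1 : i ∈ G₁ ↔ j ∈ G₁ := by rw [← hj1] at hi1; simpa using hi1
  have h2 : i ∈ G₂ ↔ j ∈ G₂ := by rw [← hj2] at hi2; simpa using hi2
  refine ⟨(card_swap hiS hjS).trans hS.1, ?_, ?_⟩
  · rw [card_swap_inter hiS hjS h1]; exact hS.2.1
  · rw [card_swap_inter hiS hjS h2]; exact hS.2.2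

lemma sum_sub_sum_eq_sdiff (g : Fin m → ℝ) (W S : Finset (Fin m)) :
    ∑ i ∈ W, g i - ∑ i ∈ S, g i = ∑ i ∈ W \ S, g i - ∑ i ∈ S \ W, g i := by
  rw [← Finset.sum_inter_add_sum_sdiff W S g, ← Finset.sum_inter_add_sum_sdiff S W g,
    Finset.inter_comm S W]
  ring

/-- Weak duality with slack. In comparing `S` with `T` the `θ` terms cancel, since both have `n`
items. The penalties of `T` exceed those of `S` by at most `l₁ + l₂`, since `T` overshoots each
bound by at most one; here the signs of the multipliers matter. As `W` collects the nonnegative part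
of `g`, its advantage over `S` is exactly the sum of `|g|` over the symmetric difference. -/
lemma sum_abs_sdiff_le {L₁ L₂ l₁ l₂ θ B : ℝ} {u g : Fin m → ℝ} {W S T : Finset (Fin m)}
    (hl₁ : 0 ≤ l₁) (hl₂ : 0 ≤ l₂)
    (hu : ∀ i, u i = g i + θ - l₁ * (if i ∈ G₁ then 1 else 0) - l₂ * (if i ∈ G₂ then 1 else 0))
    (hB : ∀ i, |g i| ≤ B) (hpos : ∀ i ∈ W, 0 ≤ g i) (hneg : ∀ i ∉ W, g i ≤ 0)
    (hS : IsBestSelection (feasible n G₁ G₂ L₁ L₂) u S) (hT : T ∈ feasible n G₁ G₂ L₁ L₂)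
    (hT₁ : ((T ∩ G₁).card : ℝ) ≤ L₁ + 1) (hT₂ : ((T ∩ G₂).card : ℝ) ≤ L₂ + 1) :
    ∑ i ∈ W \ S, |g i| + ∑ i ∈ S \ W, |g i|
      ≤ B * (((T \ W).card : ℝ) + (W \ T).card) + l₁ + l₂ := by
  have hsum : ∀ X : Finset (Fin m), ∑ i ∈ X, u i
      = ∑ i ∈ X, g i + X.card * θ - l₁ * (X ∩ G₁).card - l₂ * (X ∩ G₂).card := fun X => by
    simp_rw [hu, Finset.sum_sub_distrib, Finset.sum_add_distrib, ← Finset.mul_sum]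
    simp [Finset.sum_ite_mem]
  have h := hS.2 T hT
  rw [hsum, hsum, hT.1, hS.1.1] at h
  have h1 : l₁ * (T ∩ G₁).card ≤ l₁ * ((S ∩ G₁).card + 1) :=
    mul_le_mul_of_nonneg_left (by linarith [hS.1.2.1]) hl₁
  have h2 : l₂ * (T ∩ G₂).card ≤ l₂ * ((S ∩ G₂).card + 1) :=
    mul_le_mul_of_nonneg_left (by linarith [hS.1.2.2]) hl₂
  have e1 := sum_sub_sum_eq_sdiff g W S
  have e2 := sum_sub_sum_eq_sdiff g W T
  have a1 : ∑ i ∈ W \ S, |g i| = ∑ i ∈ W \ S, g i :=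
    Finset.sum_congr rfl fun i hi => abs_of_nonneg (hpos i (Finset.mem_sdiff.1 hi).1)
  have a2 : ∑ i ∈ S \ W, |g i| = - ∑ i ∈ S \ W, g i := by
    rw [← Finset.sum_neg_distrib]
    exact Finset.sum_congr rfl fun i hi => abs_of_nonpos (hneg i (Finset.mem_sdiff.1 hi).2)
  have b1 : ∑ i ∈ W \ T, g i ≤ (W \ T).card * B := by
    rw [← nsmul_eq_mul]
    exact Finset.sum_le_card_nsmul _ _ _ fun i _ => (le_abs_self _).trans (hB i)
  have b2 : (T \ W).card * -B ≤ ∑ i ∈ T \ W, g i := by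
    rw [← nsmul_eq_mul]
    exact Finset.card_nsmul_le_sum _ _ _ fun i _ => (abs_le.1 (hB i)).1
  rw [a1, a2]
  linarith

lemma card_mul_le_sum_abs {g : Fin m → ℝ} {κ : ℝ} (Z N : Finset (Fin m)) (hκ : 0 ≤ κ)
    (hN : ∀ i ∉ N, κ ≤ |g i|) : Z.card * κ ≤ ∑ i ∈ Z, |g i| + N.card * κ := by
  have h1 : ((Z \ N).card : ℝ) * κ ≤ ∑ i ∈ Z \ N, |g i| := by
    rw [← nsmul_eq_mul]
    exact Finset.card_nsmul_le_sum _ _ _ fun i hi => hN i (Finset.mem_sdiff.1 hi).2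
  have h2 : ∑ i ∈ Z \ N, |g i| ≤ ∑ i ∈ Z, |g i| :=
    Finset.sum_le_sum_of_subset_of_nonneg Finset.sdiff_subset fun _ _ _ => abs_nonneg _
  have h3 : (Z.card : ℝ) ≤ (Z \ N).card + N.card := by
    exact_mod_cast Finset.card_le_card_sdiff_add_card
  nlinarith

/-- If the optimum contains an item outside `W`, an exchange shows that it contains all of `W`, so
the excess is exactly the difference in size. -/
lemma IsBestSelection.card_sdiff_le {w : Fin m → ℝ} {q : ℝ} {X W : Finset (Fin m)}
    (hX : IsBestSelection {S | S.card = n} w X) (hW : ∀ i, i ∈ W ↔ q < w i) :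
    ((X \ W).card : ℝ) ≤ |(W.card : ℝ) - n| := by
  rcases (X \ W).eq_empty_or_nonempty with h | ⟨j, hj⟩
  · simp [h]
  obtain ⟨hjX, hjW⟩ := Finset.mem_sdiff.1 hj
  have hWX : W ⊆ X := fun i hi => by
    by_contra hiX
    have h1 := hX.le_of_swap hiX hjX ((card_swap hiX hjX).trans hX.1)
    exact hjW ((hW j).2 (((hW i).1 hi).trans_le h1))
  have hXn : X.card = n := hX.1
  rw [Finset.cast_card_sdiff hWX, hXn, abs_sub_comm]
  exact le_abs_self _

/-- Each missed item is worth at most the average of its `Q`, hence at most a fraction `1 / K` of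
the utility of `S`. The loss is thus relative, with no need for bounds on the utilities themselves.
-/
lemma sum_le_of_sdiff_dominated {w : Fin m → ℝ} (hw : ∀ i, 0 ≤ w i) {S X : Finset (Fin m)}
    {K a : ℝ} (hK : 0 < K)
    (hdom : ∀ i ∈ X \ S, ∃ Q ⊆ S, K ≤ (Q.card : ℝ) ∧ ∀ j ∈ Q, w i ≤ w j)
    (hcard : ((X \ S).card : ℝ) ≤ a * K) : ∑ i ∈ X, w i ≤ (1 + a) * ∑ i ∈ S, w i := by
  have hS0 : 0 ≤ ∑ i ∈ S, w i := Finset.sum_nonneg fun i _ => hw i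
  have h1 : ∀ i ∈ X \ S, w i ≤ (∑ i ∈ S, w i) / K := fun i hi => by
    obtain ⟨Q, hQS, hQK, hQ⟩ := hdom i hi
    rw [le_div_iff₀ hK]
    calc w i * K ≤ Q.card * w i := by nlinarith [hw i]
      _ ≤ ∑ j ∈ Q, w j := by
        rw [← nsmul_eq_mul]; exact Finset.card_nsmul_le_sum _ _ _ hQ
      _ ≤ ∑ j ∈ S, w j := Finset.sum_le_sum_of_subset_of_nonneg hQS fun i _ _ => hw i
  have h2 : ∑ i ∈ X \ S, w i ≤ a * ∑ i ∈ S, w i := by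
    calc ∑ i ∈ X \ S, w i ≤ (X \ S).card * ((∑ i ∈ S, w i) / K) := by
          rw [← nsmul_eq_mul]; exact Finset.sum_le_card_nsmul _ _ _ h1
      _ ≤ a * K * ((∑ i ∈ S, w i) / K) := by gcongr
      _ = _ := by field_simp
  have h3 : ∑ i ∈ X ∩ S, w i ≤ ∑ i ∈ S, w i :=
    Finset.sum_le_sum_of_subset_of_nonneg Finset.inter_subset_right fun i _ _ => hw i
  rw [← Finset.sum_inter_add_sum_sdiff X S w]
  linarith

end Selections

/-! ### The deterministic estimate for typical utilities -/

lemma card_eq_sum_card_intersection {m : ℕ} (G₁ G₂ : Finset (Fin m)) :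
    m = (intersection G₁ G₂ false false).card + (intersection G₁ G₂ true false).card
      + (intersection G₁ G₂ false true).card + (intersection G₁ G₂ true true).card := by
  simpa using card_eq_sum_inter_intersection (G₁ := G₁) (G₂ := G₂) Finset.univ

lemma exists_feasible_near {m n : ℕ} {G₁ G₂ : Finset (Fin m)} {r e : ℝ} (hn : (n : ℝ) = m * r)
    (hlo : ∀ s t, 2 ≤ (intersection G₁ G₂ s t).card * r)
    (hhi : ∀ s t, (intersection G₁ G₂ s t).card * r + 2 ≤ (intersection G₁ G₂ s t).card)
    (W : Finset (Fin m))
    (hW : ∀ s t, |((W ∩ intersection G₁ G₂ s t).card : ℝ) - (intersection G₁ G₂ s t).card * r|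
      ≤ e) :
    ∃ T ∈ feasible n G₁ G₂ (G₁.card * r) (G₂.card * r),
      ((T ∩ G₁).card : ℝ) ≤ G₁.card * r + 1 ∧ ((T ∩ G₂).card : ℝ) ≤ G₂.card * r + 1 ∧
      ((T \ W).card : ℝ) + (W \ T).card ≤ 4 * (e + 2) := by
  obtain ⟨k, hkN, hkr, hk, h1, h1', h2, h2'⟩ := exists_rounding
    (N := fun s t => (intersection G₁ G₂ s t).card) (n := n) (r := r)
    (by rw [hn]; congr 2; exact card_eq_sum_card_intersection G₁ G₂) hlo hhi
  obtain ⟨T, hT, hTW⟩ := exists_selection_near W hkN (a := e + 2) fun s t => by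
    have a1 := abs_le.1 (hkr s t)
    have a2 := abs_le.1 (hW s t)
    exact abs_le.2 ⟨by linarith, by linarith⟩
  have hG₁ := card_inter_left_eq (G₁ := G₁) (G₂ := G₂) Finset.univ
  have hG₂ := card_inter_right_eq (G₁ := G₁) (G₂ := G₂) Finset.univ
  simp only [Finset.univ_inter] at hG₁ hG₂
  have hT₁ : (T ∩ G₁).card = k true false + k true true := by
    rw [card_inter_left_eq (G₁ := G₁) (G₂ := G₂), hT, hT]
  have hT₂ : (T ∩ G₂).card = k false true + k true true := by
    rw [card_inter_right_eq (G₁ := G₁) (G₂ := G₂), hT, hT]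
  have hTn : T.card = n := by
    rw [card_eq_sum_inter_intersection (G₁ := G₁) (G₂ := G₂), hT, hT, hT, hT, hk]
  refine ⟨T, ⟨hTn, ?_, ?_⟩, ?_, ?_, hTW⟩
  · rw [hT₁, hG₁]; exact h1
  · rw [hT₂, hG₂]; exact h2
  · rw [hT₁, hG₁]; exact h1'
  · rw [hT₂, hG₂]; exact h2'

-- The whole argument for one outcome `w` with typical counts: `W` holds the items above the
-- threshold `q`, and `N` those in the quantile window, where `|g|` may be too small to detect a
-- misplaced item.
set_option maxHeartbeats 1000000 in
lemma sum_best_le_of_counts {m n : ℕ} {G₁ G₂ : Finset (Fin m)}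
    {ε η ρ c d τ δ ζ r q x₁ x₂ : ℝ} (hη : 0 < η) (hρ : 0 < ρ) (hc : 0 < c)
    (hd : 0 < d) (hτ : 0 < τ) (hm : (0 : ℝ) < m)
    (hζη : ζ ≤ ρ * η / 2) (hζε : ζ ≤ ε * (ρ * η) / 4) (hτζ : 2 * τ ≤ ζ / 4) (hδζ : 5 * δ ≤ ζ / 4)
    (hδκ : 5 * (1 / c) * δ ≤ ζ / 4 * (d * c * τ)) (hδm : 10 ≤ δ * m)
    (hn : (n : ℝ) = m * r) (hr : η ≤ r)
    (hlo : ∀ s t, 2 ≤ (intersection G₁ G₂ s t).card * r)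
    (hhi : ∀ s t, (intersection G₁ G₂ s t).card * r + 2 ≤ (intersection G₁ G₂ s t).card)
    (hI : ∀ s t, ρ * m ≤ (intersection G₁ G₂ s t).card)
    {D : Measure ℝ} [IsProbabilityMeasure D] {f : ℝ → ℝ} (hD : RegularDistribution c D f)
    {b : Bool → Bool → ℝ → ℝ} (hb : ∀ s t, RegularBias c d D (b s t)) (hq : q ∈ D.support)
    (hx₁q : x₁ ≤ q) (hx₂q : q ≤ x₂)
    (hD₁ : τ ≤ D.real (Set.Icc x₁ q)) (hD₂ : τ ≤ D.real (Set.Icc q x₂))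
    (hb₁ : b true false q ≤ b false false q) (hb₂ : b false true q ≤ b false false q)
    (hb₀ : b false false q - b true false q - b false true q + b true true q = 0)
    {w : Fin m → ℝ} (hw : ∀ i, w i ∈ D.support) {S X W N : Finset (Fin m)}
    (hW : ∀ i, i ∈ W ↔ q < w i) (hN : ∀ i, i ∈ N ↔ w i ∈ Set.Icc x₁ x₂)
    (hWc : ∀ s t, |((W ∩ intersection G₁ G₂ s t).card : ℝ) - (intersection G₁ G₂ s t).card * r|
      ≤ δ * m)
    (hNc : (N.card : ℝ) ≤ (2 * τ + δ) * m)
    (hS : IsBestSelection (feasible n G₁ G₂ (G₁.card * r) (G₂.card * r)) (observed b G₁ G₂ w) S)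
    (hX : IsBestSelection {S | S.card = n} w X) :
    ∑ i ∈ X, w i ≤ (1 + ε / 2) * ∑ i ∈ S, w i := by
  have hw0 : ∀ i, 0 ≤ w i := fun i => hD.support_nonneg (hw i)
  have hq0 : 0 ≤ q := hD.support_nonneg hq
  obtain ⟨T, hT, hT₁, hT₂, hTW⟩ := exists_feasible_near hn hlo hhi W hWc
  have hb0 : ∀ s t x, x ∈ D.support → 0 ≤ b s t x ∧ b s t x ≤ 1 / c := fun s t x hx =>
    ⟨(hb s t).mapsTo (hD.support_nonneg hx), (hb s t).value_le x hx⟩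
  let g : Fin m → ℝ := fun i => b (decide (i ∈ G₁)) (decide (i ∈ G₂)) (w i)
    - b (decide (i ∈ G₁)) (decide (i ∈ G₂)) q
  have hgB : ∀ i, |g i| ≤ 1 / c := fun i => by
    have h1 := hb0 (decide (i ∈ G₁)) (decide (i ∈ G₂)) _ (hw i)
    have h2 := hb0 (decide (i ∈ G₁)) (decide (i ∈ G₂)) _ hq
    exact abs_le.2 ⟨by simp only [g]; linarith, by simp only [g]; linarith⟩
  have hmain := sum_abs_sdiff_le (g := g) (W := W) (θ := b false false q) (B := 1 / c)
    (l₁ := b false false q - b true false q) (l₂ := b false false q - b false true q)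
    (by linarith) (by linarith)
    -- For items in both groups this decomposition is the hypothesis `hb₀`; the other three cases
    -- hold by the choice of `θ`, `l₁` and `l₂`.
    (fun i => by
      by_cases h1 : i ∈ G₁ <;> by_cases h2 : i ∈ G₂ <;> simp [g, observed, h1, h2] <;> linarith)
    hgB
    (fun i hi => sub_nonneg.2 ((hb _ _).strictMonoOn.monotoneOn hq0 (hw0 i) ((hW i).1 hi).le))
    (fun i hi => sub_nonpos.2 ((hb _ _).strictMonoOn.monotoneOn (hw0 i) hq0
      (not_lt.1 fun h => hi ((hW i).2 h))))
    hS hT hT₁ hT₂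
  have hκ : 0 < d * c * τ := by positivity
  have hgN : ∀ i ∉ N, d * c * τ ≤ |g i| := fun i hi => by
    rw [hN, Set.mem_Icc, not_and_or, not_le, not_le] at hi
    rcases hi with hi | hi
    · have h1 := (hb (decide (i ∈ G₁)) (decide (i ∈ G₂))).mul_real_Icc_le hc hd hD (hw0 i)
        (hi.le.trans hx₁q)
      have h2 : D.real (Set.Icc x₁ q) ≤ D.real (Set.Icc (w i) q) :=
        measureReal_mono (Set.Icc_subset_Icc_left hi.le)
      rw [abs_sub_comm]
      refine le_trans ?_ (h1.trans (le_abs_self _))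
      gcongr
      exact hD₁.trans h2
    · have h1 := (hb (decide (i ∈ G₁)) (decide (i ∈ G₂))).mul_real_Icc_le hc hd hD hq0
        (hx₂q.trans hi.le)
      have h2 : D.real (Set.Icc q x₂) ≤ D.real (Set.Icc q (w i)) :=
        measureReal_mono (Set.Icc_subset_Icc_right hi.le)
      refine le_trans ?_ (h1.trans (le_abs_self _))
      gcongr
      exact hD₂.trans h2
  have hdisj : Disjoint (W \ S) (S \ W) := by
    rw [Finset.disjoint_left]
    exact fun i h h' => (Finset.mem_sdiff.1 h).2 (Finset.mem_sdiff.1 h').1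
  have hcount := card_mul_le_sum_abs (g := g) ((W \ S) ∪ (S \ W)) N hκ.le hgN
  rw [Finset.card_union_of_disjoint hdisj, Finset.sum_union hdisj] at hcount
  have hWS : ((W \ S).card : ℝ) ≤ (ζ / 2 + δ) * m := by
    have hc' : (0 : ℝ) < 1 / c := by positivity
    -- Rounding contributes `8 / c` and the multipliers at most `2 / c`; together `10 / c`, absorbed
    -- as a fifth `δ * m / c` by `hδm`.
    have h1 : ∑ i ∈ W \ S, |g i| + ∑ i ∈ S \ W, |g i| ≤ ζ / 4 * m * (d * c * τ) := by
      have h2 : 1 / c * (((T \ W).card : ℝ) + (W \ T).card) ≤ 1 / c * (4 * (δ * m + 2)) :=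
        mul_le_mul_of_nonneg_left hTW hc'.le
      have h3 : 1 / c * 10 ≤ 1 / c * (δ * m) := mul_le_mul_of_nonneg_left hδm hc'.le
      have h4 := mul_le_mul_of_nonneg_right hδκ hm.le
      linarith [(hb0 false false q hq).2, (hb0 true false q hq).1, (hb0 false true q hq).1]
    have h2 : ((W \ S).card : ℝ) * (d * c * τ)
        ≤ (ζ / 4 * m + (2 * τ + δ) * m) * (d * c * τ) := by
      calc ((W \ S).card : ℝ) * (d * c * τ)
          ≤ (((W \ S).card + (S \ W).card : ℕ) : ℝ) * (d * c * τ) := by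
            gcongr; exact Nat.le_add_right _ _
        _ ≤ ζ / 4 * m * (d * c * τ) + N.card * (d * c * τ) := by linarith
        _ ≤ ζ / 4 * m * (d * c * τ) + (2 * τ + δ) * m * (d * c * τ) := by gcongr
        _ = _ := by ring
    have h3 := le_of_mul_le_mul_right h2 hκ
    have h4 := mul_le_mul_of_nonneg_right hτζ hm.le
    linarith
  have hXW : ((X \ W).card : ℝ) ≤ 4 * (δ * m) := by
    refine (hX.card_sdiff_le hW).trans ?_
    rw [hn, card_eq_sum_inter_intersection (G₁ := G₁) (G₂ := G₂) W]
    have hm' : (m : ℝ) = _ := congrArg (Nat.cast (R := ℝ)) (card_eq_sum_card_intersection G₁ G₂)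
    have a := abs_le.1 (hWc false false)
    have a' := abs_le.1 (hWc true false)
    have a'' := abs_le.1 (hWc false true)
    have a''' := abs_le.1 (hWc true true)
    have hmr : (m : ℝ) * r = _ := congrArg (· * r) hm'
    rw [hmr]
    push_cast
    exact abs_le.2 ⟨by linarith, by linarith⟩
  have hXS : ((X \ S).card : ℝ) ≤ ζ * m := by
    have h1 : (X \ S).card ≤ (X \ W).card + (W \ S).card := by
      refine (Finset.card_le_card fun i hi => ?_).trans (Finset.card_union_le _ _)
      simp only [Finset.mem_union, Finset.mem_sdiff] at hi ⊢
      tauto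
    have h2 : ((X \ S).card : ℝ) ≤ (X \ W).card + (W \ S).card := by exact_mod_cast h1
    have h4 := mul_le_mul_of_nonneg_right hδζ hm.le
    linarith
  -- `W` has at least `(ρ * η - δ) * m` items in every intersection, and passing to `S` costs at
  -- most `(ζ / 2 + δ) * m`; the total loss is at most `ζ * m`, hence at most half of `ρ * η * m`.
  refine sum_le_of_sdiff_dominated hw0 (K := ρ * η / 2 * m) (by positivity) (fun i hi => ?_) ?_
  · obtain ⟨-, hiS⟩ := Finset.mem_sdiff.1 hi
    obtain ⟨s, hs⟩ : ∃ s, decide (i ∈ G₁) = s := ⟨_, rfl⟩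
    obtain ⟨t, ht⟩ : ∃ t, decide (i ∈ G₂) = t := ⟨_, rfl⟩
    have hiI : i ∈ intersection G₁ G₂ s t := mem_intersection.2 ⟨hs, ht⟩
    refine ⟨S ∩ intersection G₁ G₂ s t, Finset.inter_subset_left, ?_, fun j hj => ?_⟩
    · have h1 : (W ∩ intersection G₁ G₂ s t).card
          ≤ (S ∩ intersection G₁ G₂ s t).card + (W \ S).card := by
        refine (Finset.card_le_card fun i hi => ?_).trans (Finset.card_union_le _ _)
        simp only [Finset.mem_union, Finset.mem_sdiff, Finset.mem_inter] at hi ⊢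
        tauto
      have h2 : ((W ∩ intersection G₁ G₂ s t).card : ℝ)
          ≤ (S ∩ intersection G₁ G₂ s t).card + (W \ S).card := by exact_mod_cast h1
      have h3 := (abs_le.1 (hWc s t)).1
      have h4 : ρ * m * η ≤ (intersection G₁ G₂ s t).card * r := by
        gcongr
        exact hI s t
      have h5 := mul_le_mul_of_nonneg_right hδζ hm.le
      have h6 := mul_le_mul_of_nonneg_right hζη hm.le
      linarith
    · obtain ⟨hjS, hjI⟩ := Finset.mem_inter.1 hj
      have h1 := hS.le_of_swap hiS hjS (swap_mem_feasible hS.1 hiI hjI hiS hjS)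
      obtain ⟨hj1, hj2⟩ := mem_intersection.1 hjI
      simp only [observed, hs, ht, hj1, hj2] at h1
      exact ((hb s t).strictMonoOn.le_iff_le (hw0 i) (hw0 j)).1 h1
  · refine hXS.trans ?_
    have := mul_le_mul_of_nonneg_right hζε hm.le
    linarith

/-! ### The exceptional event, the choice of constants, and the conclusion -/

lemma sum_indicator_eq_card_inter {m : ℕ} (A : Set ℝ) (w : Fin m → ℝ) {V I : Finset (Fin m)}
    (hV : ∀ i, i ∈ V ↔ w i ∈ A) : ∑ i ∈ I, A.indicator (1 : ℝ → ℝ) (w i) = (V ∩ I).card := by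
  classical
  rw [Finset.card_eq_sum_ones, Nat.cast_sum, Finset.inter_comm, ← Finset.sum_ite_mem]
  refine Finset.sum_congr rfl fun i _ => ?_
  by_cases h : w i ∈ A
  · simp [h, (hV i).2 h]
  · simp [h, mt (hV i).1 h]

lemma exists_real_Icc_eq (D : Measure ℝ) [IsProbabilityMeasure D] [NullSingletonClass D]
    {q p τ : ℝ} (hq : cdf D q = p) (hτ : 0 < τ) (h0 : τ < p) (h1 : p + τ < 1) :
    ∃ x₁ x₂, x₁ ≤ q ∧ q ≤ x₂ ∧ D.real (Set.Icc x₁ q) = τ ∧ D.real (Set.Icc q x₂) = τ ∧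
      D.real (Set.Icc x₁ x₂) = 2 * τ := by
  obtain ⟨x₁, hx₁⟩ := exists_cdf_eq D (p := p - τ) (by linarith) (by linarith)
  obtain ⟨x₂, hx₂⟩ := exists_cdf_eq D (p := p + τ) (by linarith) (by linarith)
  have h₁ : x₁ ≤ q := (monotone_cdf D).reflect_lt (by rw [hx₁, hq]; linarith) |>.le
  have h₂ : q ≤ x₂ := (monotone_cdf D).reflect_lt (by rw [hx₂, hq]; linarith) |>.le
  refine ⟨x₁, x₂, h₁, h₂, ?_, ?_, ?_⟩
  · rw [← cdf_sub_cdf_eq_real_Icc D h₁]; linarith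
  · rw [← cdf_sub_cdf_eq_real_Icc D h₂]; linarith
  · rw [← cdf_sub_cdf_eq_real_Icc D (h₁.trans h₂)]; linarith

/-- The latent utilities for which the number of items of `I` with utility in `A` differs from its
mean by at least `δ * m`. -/
def deviation {m : ℕ} (D : Measure ℝ) (A : Set ℝ) (I : Finset (Fin m)) (δ : ℝ) :
    Set (Fin m → ℝ) :=
  {w | δ * m ≤ |(∑ i ∈ I, A.indicator 1 (w i)) - I.card * D.real A|}

lemma measurableSet_deviation {m : ℕ} (D : Measure ℝ) {A : Set ℝ} (hA : MeasurableSet A)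
    (I : Finset (Fin m)) (δ : ℝ) : MeasurableSet (deviation D A I δ) := by
  refine measurableSet_le measurable_const (continuous_abs.measurable.comp
    ((Finset.measurable_sum _ fun i _ => ?_).sub_const _))
  exact (measurable_one.indicator hA).comp (measurable_pi_apply i)

lemma exists_tolerances {ε η ρ c d : ℝ} (hε : 0 < ε) (hη : 0 < η) (hρ : 0 < ρ) (hc : 0 < c)
    (hd : 0 < d) : ∃ τ δ ζ : ℝ, 0 < τ ∧ 0 < δ ∧ τ < η ∧ ζ ≤ ρ * η / 2 ∧ ζ ≤ ε * (ρ * η) / 4 ∧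
      2 * τ ≤ ζ / 4 ∧ 5 * δ ≤ ζ / 4 ∧ 5 * (1 / c) * δ ≤ ζ / 4 * (d * c * τ) := by
  obtain ⟨ζ, hζ⟩ : ∃ ζ, ζ = min (ρ * η / 2) (ε * (ρ * η) / 4) := ⟨_, rfl⟩
  have hζ0 : 0 < ζ := by rw [hζ]; positivity
  obtain ⟨τ, hτ⟩ : ∃ τ, τ = min (ζ / 8) (η / 2) := ⟨_, rfl⟩
  have hτ0 : 0 < τ := by rw [hτ]; positivity
  have hτζ : τ ≤ ζ / 8 := hτ ▸ min_le_left _ _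
  have hτη : τ ≤ η / 2 := hτ ▸ min_le_right _ _
  obtain ⟨δ, hδ⟩ : ∃ δ, δ = min (ζ / 20) (ζ / 20 * (d * c * τ) * c) := ⟨_, rfl⟩
  have hδ0 : 0 < δ := by rw [hδ]; positivity
  have hδ1 : δ ≤ ζ / 20 := hδ ▸ min_le_left _ _
  have hδ2 : δ ≤ ζ / 20 * (d * c * τ) * c := hδ ▸ min_le_right _ _
  refine ⟨τ, δ, ζ, hτ0, hδ0, by linarith, hζ ▸ min_le_left _ _, hζ ▸ min_le_right _ _,
    by linarith, by linarith, ?_⟩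
  calc 5 * (1 / c) * δ ≤ 5 * (1 / c) * (ζ / 20 * (d * c * τ) * c) := by gcongr
    _ = ζ / 4 * (d * c * τ) := by field_simp; ring

/-- Almost surely `R` is at least `a` minus the indicator of `E`: on `E` this lower bound is
nonpositive because `a ≤ 1`. -/
lemma integrable_and_le_integral_of_ae {Ω : Type*} [MeasurableSpace Ω] {μ : Measure Ω}
    [IsProbabilityMeasure μ] {R : Ω → ℝ} (hR : AEStronglyMeasurable R μ) {E : Set Ω}
    (hE : MeasurableSet E) {a e : ℝ} (he : μ.real E ≤ e) (ha : a ≤ 1)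
    (h : ∀ᵐ ω ∂μ, 0 ≤ R ω ∧ R ω ≤ 1 ∧ (ω ∉ E → a ≤ R ω)) :
    Integrable R μ ∧ a - e ≤ ∫ ω, R ω ∂μ := by
  have hint : Integrable R μ := Integrable.of_bound hR 1 (h.mono fun ω hω => by
    rw [Real.norm_eq_abs, abs_of_nonneg hω.1]; exact hω.2.1)
  have hE1 : Integrable (E.indicator (1 : Ω → ℝ)) μ := (integrable_const (1 : ℝ)).indicator hE
  refine ⟨hint, ?_⟩
  calc a - e ≤ a - μ.real E := by linarith
    _ = ∫ ω, (a - E.indicator (1 : Ω → ℝ) ω) ∂μ := by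
        rw [integral_sub (integrable_const a) hE1, integral_indicator_one hE]; simp
    _ ≤ ∫ ω, R ω ∂μ := integral_mono_ae ((integrable_const a).sub hE1) hint
        (h.mono fun ω hω => by
          by_cases hωE : ω ∈ E
          · simp only [Set.indicator_of_mem hωE, Pi.one_apply]; linarith [hω.1]
          · simp only [Set.indicator_of_notMem hωE]; linarith [hω.2.2 hωE])

theorem mainTheorem5 (ε η ρ c d : ℝ) (hε : 0 < ε) (hη : 0 < η) (hρ : 0 < ρ) (hc : 0 < c)
    (hd : 0 < d) :
    ∃ m₀ : ℕ, ∀ (m : ℕ), m₀ ≤ m →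
      ∀ (n : ℕ), η < (n : ℝ) / m → (n : ℝ) / m < 1 - η →
      ∀ (G₁ G₂ : Finset (Fin m)),
        (∀ s t : Bool, ρ * m ≤ ((intersection G₁ G₂ s t).card : ℝ)) →
      ∀ (D : Measure ℝ) [IsProbabilityMeasure D] (f : ℝ → ℝ), RegularDistribution c D f →
      ∀ (b : Bool → Bool → ℝ → ℝ), (∀ s t : Bool, RegularBias c d D (b s t)) →
      ∀ (q : ℝ), q = quantile D (1 - (n : ℝ) / m) →
        b true false q ≤ b false false q →
        b false true q ≤ b false false q →
        b false false q - b true false q - b false true q + b true true q = 0 →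
      ∃ L₁ L₂ : ℝ, 0 ≤ L₁ ∧ 0 ≤ L₂ ∧
        L₁ = (G₁.card : ℝ) * ((n : ℝ) / m) ∧ L₂ = (G₂.card : ℝ) * ((n : ℝ) / m) ∧
        (feasible n G₁ G₂ L₁ L₂).Nonempty ∧
        ∀ (xt xs : (Fin m → ℝ) → Finset (Fin m)),
          (∀ w, IsBestSelection (feasible n G₁ G₂ L₁ L₂) (observed b G₁ G₂ w) (xt w)) →
          (∀ w, IsBestSelection {S | S.card = n} w (xs w)) →
          Integrable (selectionRatio xt xs) (latentLaw m D) ∧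
            1 - ε ≤ utilityRatio D xt xs := by
  obtain ⟨τ, δ, ζ, hτ, hδ, hτη, hζη, hζε, hτζ, hδζ, hδκ⟩ := exists_tolerances hε hη hρ hc hd
  -- The three terms absorb the additive rounding errors, leave room for rounding in every
  -- intersection, and bring five Chebyshev bounds below `ε / 2` in total.
  obtain ⟨m₀, hm₀⟩ := exists_nat_ge (10 / δ + 2 / (ρ * η) + 10 / (δ ^ 2 * ε))
  refine ⟨m₀, fun m hm n hn₁ hn₂ G₁ G₂ hI D _ f hD b hb q hq hb₁ hb₂ hb₀ => ?_⟩
  have hm0 : 0 < m := by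
    rcases Nat.eq_zero_or_pos m with rfl | h
    · simp at hn₁; linarith
    · exact h
  have hmR : (0 : ℝ) < m := Nat.cast_pos.2 hm0
  have hmm : 10 / δ + 2 / (ρ * η) + 10 / (δ ^ 2 * ε) ≤ m := hm₀.trans (Nat.cast_le.2 hm)
  have p1 : 0 < 10 / δ := by positivity
  have p2 : 0 < 2 / (ρ * η) := by positivity
  have p3 : 0 < 10 / (δ ^ 2 * ε) := by positivity
  have hδm : 10 ≤ δ * m := by
    have : 10 / δ ≤ m := by linarith
    rwa [div_le_iff₀ hδ, mul_comm] at this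
  have hρm : 2 ≤ ρ * m * η := by
    have : 2 / (ρ * η) ≤ m := by linarith
    rw [div_le_iff₀ (by positivity)] at this
    linarith
  have hprob : 5 * (1 / (δ ^ 2 * m)) ≤ ε / 2 := by
    have : 10 / (δ ^ 2 * ε) ≤ m := by linarith
    rw [div_le_iff₀ (by positivity)] at this
    rw [mul_one_div, div_le_iff₀ (by positivity)]
    linarith
  obtain ⟨r, hr⟩ : ∃ r, r = (n : ℝ) / m := ⟨_, rfl⟩
  rw [← hr] at hn₁ hn₂ hq ⊢
  have hnr : (n : ℝ) = m * r := by rw [hr]; field_simp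
  have hlo : ∀ s t, 2 ≤ (intersection G₁ G₂ s t).card * r := fun s t =>
    hρm.trans (mul_le_mul (hI s t) hn₁.le hη.le (Nat.cast_nonneg _))
  have hhi : ∀ s t, (intersection G₁ G₂ s t).card * r + 2 ≤ (intersection G₁ G₂ s t).card :=
    fun s t => by
      have : ρ * m * η ≤ (intersection G₁ G₂ s t).card * (1 - r) :=
        mul_le_mul (hI s t) (by linarith) hη.le (Nat.cast_nonneg _)
      linarith
  have hr0 : 0 ≤ r := by linarith
  refine ⟨G₁.card * r, G₂.card * r, mul_nonneg (Nat.cast_nonneg _) hr0,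
    mul_nonneg (Nat.cast_nonneg _) hr0, rfl, rfl, ?_, ?_⟩
  -- Only feasibility matters here, so the empty reference set with the trivial error `m` suffices.
  · obtain ⟨T, hT, -⟩ := exists_feasible_near (e := m) hnr hlo hhi ∅ fun s t => by
      have h1 : ((intersection G₁ G₂ s t).card : ℝ) ≤ m := by
        simpa using Nat.cast_le (α := ℝ).2 (Finset.card_le_univ (intersection G₁ G₂ s t))
      rw [Finset.empty_inter, Finset.card_empty, Nat.cast_zero, zero_sub, abs_neg,
        abs_of_nonneg (mul_nonneg (Nat.cast_nonneg _) hr0)]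
      linarith [hhi s t]
    exact ⟨T, hT⟩
  intro xt xs hxt hxs
  have := hD.nullSingletonClass
  have hprobm : IsProbabilityMeasure (latentLaw m D) := by unfold latentLaw; infer_instance
  have hsupp : ∀ᵐ x ∂D, x ∈ D.support := Measure.support_mem_ae
  have hnonneg : ∀ᵐ x ∂D, x ∈ Set.Ici (0 : ℝ) := hsupp.mono hD.support_nonneg
  have hcdf : cdf D q = 1 - r := by rw [hq]; exact cdf_quantile D (by linarith) (by linarith)
  have hqs : q ∈ D.support := by
    rw [hq]; exact quantile_mem_support D (by linarith) (by linarith)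
  have hDq : D.real (Set.Ioi q) = r := by
    rw [← Set.compl_Iic, probReal_compl_eq_one_sub measurableSet_Iic, ← cdf_eq_real, hcdf]
    ring
  obtain ⟨x₁, x₂, hx₁q, hx₂q, hD₁, hD₂, hD₁₂⟩ :=
    exists_real_Icc_eq D hcdf hτ (by linarith) (by linarith)
  let E : Set (Fin m → ℝ) :=
    (⋃ p : Bool × Bool, deviation D (Set.Ioi q) (intersection G₁ G₂ p.1 p.2) δ) ∪
      deviation D (Set.Icc x₁ x₂) Finset.univ δ
  have hE : MeasurableSet E := (MeasurableSet.iUnion fun p =>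
    measurableSet_deviation D measurableSet_Ioi _ δ).union
      (measurableSet_deviation D measurableSet_Icc _ δ)
  have hPE : (latentLaw m D).real E ≤ ε / 2 := by
    refine le_trans ?_ hprob
    calc (latentLaw m D).real E
        ≤ ∑ p : Bool × Bool, (latentLaw m D).real
            (deviation D (Set.Ioi q) (intersection G₁ G₂ p.1 p.2) δ)
          + (latentLaw m D).real (deviation D (Set.Icc x₁ x₂) Finset.univ δ) :=
          (measureReal_union_le _ _).trans (by gcongr; exact measureReal_iUnion_fintype_le _)
      _ ≤ ∑ _p : Bool × Bool, 1 / (δ ^ 2 * m) + 1 / (δ ^ 2 * m) := by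
          gcongr with p
          · exact measure_count_deviation_le D measurableSet_Ioi _ hδ hm0
          · exact measure_count_deviation_le D measurableSet_Icc _ hδ hm0
      _ = 5 * (1 / (δ ^ 2 * m)) := by
          simp only [Finset.sum_const, Finset.card_univ, Fintype.card_prod, Fintype.card_bool]
          ring
  -- Excludes a zero denominator in the ratio.
  have hpos : ∀ᵐ w ∂latentLaw m D, ∀ i, w i ≠ 0 :=
    ae_mem_latentLaw (A := {x | x ≠ 0}) (measure_eq_zero_iff_ae_notMem.1 (measure_singleton 0))
  have hn0 : 0 < n := by
    rw [← Nat.cast_pos (α := ℝ), hnr]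
    exact mul_pos hmR (by linarith)
  have hmeas : AEStronglyMeasurable (selectionRatio xt xs) (latentLaw m D) :=
    aestronglyMeasurable_selectionRatio
      (nullMeasurableSet_bestSelection hnonneg (fun i => (hb _ _).strictMonoOn) hxt)
      (nullMeasurableSet_bestSelection hnonneg (β := fun _ x => x)
        (fun _ => strictMono_id.strictMonoOn _) hxs)
  have hkey := integrable_and_le_integral_of_ae hmeas hE hPE (a := 1 - ε / 2) (by linarith) (by
    filter_upwards [ae_mem_latentLaw hsupp, hpos] with w hw hwne
    have hw0 : ∀ i, 0 ≤ w i := fun i => hD.support_nonneg (hw i)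
    have hSX : ∑ i ∈ xt w, w i ≤ ∑ i ∈ xs w, w i := (hxs w).2 _ (hxt w).1.1
    have hS0 : 0 ≤ ∑ i ∈ xt w, w i := Finset.sum_nonneg fun i _ => hw0 i
    have hX0 : 0 < ∑ i ∈ xs w, w i := by
      refine Finset.sum_pos (fun i _ => lt_of_le_of_ne (hw0 i) (hwne i).symm)
        (Finset.card_pos.1 ?_)
      have hc' : (xs w).card = n := (hxs w).1
      rwa [hc']
    refine ⟨div_nonneg hS0 hX0.le, (div_le_one hX0).2 hSX, fun hwE => ?_⟩
    simp only [E, Set.mem_union, Set.mem_iUnion, not_or, not_exists, deviation,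
      Set.mem_ofPred_eq, not_le] at hwE
    obtain ⟨hw1, hw2⟩ := hwE
    classical
    have hW : ∀ i, i ∈ Finset.univ.filter (fun i => q < w i) ↔ q < w i := fun i => by simp
    have hN : ∀ i, i ∈ Finset.univ.filter (fun i => w i ∈ Set.Icc x₁ x₂) ↔
      w i ∈ Set.Icc x₁ x₂ := fun i => by simp
    have hsum := sum_best_le_of_counts (ε := ε) hη hρ hc hd hτ hmR hζη hζε hτζ hδζ hδκ hδm hnr
      hn₁.le hlo hhi hI hD hb hqs hx₁q hx₂q hD₁.ge hD₂.ge hb₁ hb₂ hb₀ hw hW hN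
      (fun s t => by
        have h := hw1 (s, t)
        rw [sum_indicator_eq_card_inter (Set.Ioi q) w hW, hDq] at h
        exact h.le)
      (by
        rw [sum_indicator_eq_card_inter (Set.Icc x₁ x₂) w hN, hD₁₂, Finset.inter_univ,
          Finset.card_univ, Fintype.card_fin] at hw2
        linarith [(abs_lt.1 hw2).2])
      (hxt w) (hxs w)
    -- With `A` the utility of `xt w` and `B` that of `xs w`, `B ≤ (1 + ε / 2) * A` and `A ≤ B` give
    -- `(1 - ε / 2) * B ≤ A + ε / 2 * (A - B) ≤ A`.
    rw [selectionRatio, le_div_iff₀ hX0]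
    nlinarith)
  refine ⟨hkey.1, ?_⟩
  rw [utilityRatio]
  linarith [hkey.2]
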